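/- Let $A$ be a finite alphabet with $|A|\ge 2$, let $A^*$ be the free monoid on $A$, and let $|w|$ denote the length of a word $w$. The prefix metric is $d_{\rm P}(w,w')=|w|+|w'|-2|w\wedge w'|$, where $w\wedge w'$ is the longest common prefix of $w$ and $w'$. For an integer $k\ge 0$ put ${\cal P}_k=\{(w,w')\in A^*\times A^*: d_{\rm P}(w,w')\le k\}$, and let $\underline{{\cal P}_k}={\cal P}_k\setminus\{(w,w):w\in A^*\}$ be its anti-reflexive restriction. A set $X\subseteq A^*$ is $\underline{{\cal P}_k}$-independent if $\underline{{\cal P}_k}(X)\cap X=\emptyset$, where $\tau(X)=\{w' : (w,w')\in\tau \text{ for some } w\in X\}$. A set $X\subseteq A^*$ is a code if every word has at most one factorization into words of $X$; it is complete if every word of $A^*$ is a factor of some word of $X^*$; it is regular if it is recognized by a finite automaton. A code $X$ is maximal in a family ${\cal F}$ of codes if $X\in{\cal F}$ and $X\subseteq Y\in{\cal F}$ implies $Y=X$; a maximal code is one that is maximal in the family of all codes over $A$. Let $\mu(X)=\sum_{w\in X}|A|^{-|w|}$ be the uniform Bernoulli measure. (1) For every $k\ge 0$ and every regular $\underline{{\cal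 P}_k}$-independent code $X\subseteq A^*$, the following four conditions are equivalent: (i) $X$ is maximal in the family of all $\underline{{\cal P}_k}$-independent codes; (ii) $X$ is a maximal code; (iii) $X$ is complete; (iv) $\mu(X)=1$. (2) For every $k\ge 0$, every regular $\underline{{\cal P}_k}$-independent code that is not maximal in the family of $\underline{{\cal P}_k}$-independent codes is contained in a regular $\underline{{\cal P}_k}$-independent code that is maximal in that family. (3) One can decide whether a given regular code is maximal in the family of $\underline{{\cal P}_k}$-independent codes: there is an algorithm (a total computable function) which, given $k\ge 0$ and a finite automaton over $A$ whose behavior is a code $X$, decides whether $X$ is maximal in the family of $\underline{{\cal P}_k}$-independent codes. -/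

import Mathlib

open scoped ENNReal

namespace PrefixCode

variable {A : Type*}

/-- The longest common prefix `w ∧ w'` of two words. -/
def commonPrefix [DecidableEq A] : List A → List A → List A
  | a :: u, b :: v => if a = b then a :: commonPrefix u v else []
  | _, _ => []

/-- `commonPrefix w w'` is a common prefix, and every common prefix is a prefix of it. -/
theorem prefix_commonPrefix_iff [DecidableEq A] (p w w' : List A) :
    p <+: commonPrefix w w' ↔ p <+: w ∧ p <+: w' := by
  induction w generalizing p w' with
  | nil => simp +contextual [commonPrefix]
  | cons a u ih =>
    cases w' with
    | nil => simp +contextual [commonPrefix]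
    | cons b v =>
      cases p with
      | nil => simp
      | cons c q =>
        by_cases h : a = b
        · subst h
          simp only [commonPrefix, if_true, List.cons_prefix_cons, ih]
          tauto
        · simp only [commonPrefix, if_neg h, List.cons_prefix_cons, List.prefix_nil]
          constructor
          · simp
          · rintro ⟨⟨h1, -⟩, h2, -⟩
            exact absurd (h1.symm.trans h2) h

/-- The prefix metric `|w| + |w'| - 2 |w ∧ w'|`. The subtraction never truncates, since
`w ∧ w'` is a prefix of both words. -/
def prefixDist [DecidableEq A] (w w' : List A) : ℕ :=
  w.length + w'.length - 2 * (commonPrefix w w').length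

/-- The relation `P_k`: pairs of words at prefix distance at most `k`. -/
def prefixRel [DecidableEq A] (k : ℕ) : SetRel (List A) (List A) :=
  {p | prefixDist p.1 p.2 ≤ k}

/-- The anti-reflexive restriction of a binary word relation. -/
def antiReflexive (τ : SetRel (List A) (List A)) : SetRel (List A) (List A) :=
  τ \ {p | p.1 = p.2}

/-- `X` is `τ`-independent: `τ(X) ∩ X = ∅`. -/
def IsIndependent (τ : SetRel (List A) (List A)) (X : Set (List A)) : Prop :=
  τ.image X ∩ X = ∅

/-- A variable-length code: every word has at most one factorization over `X`. -/
abbrev IsCode (X : Set (List A)) : Prop :=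
  InformationTheory.UniquelyDecodable X

/-- The members of the family of codes that are independent with respect to the anti-reflexive
restriction of `P_k`. -/
def IsIndependentCode [DecidableEq A] (k : ℕ) (X : Set (List A)) : Prop :=
  IsCode X ∧ IsIndependent (antiReflexive (prefixRel k)) X

/-- A regular subset of the free monoid: one recognized by a finite automaton. -/
def IsRegularSet (X : Set (List A)) : Prop :=
  Language.IsRegular (T := A) X

/-- `X` is complete: every word is a factor of some word in the submonoid `X*`. -/
def IsComplete (X : Set (List A)) : Prop :=
  ∀ w : List A, ∃ l : List (List A), (∀ x ∈ l, x ∈ X) ∧ w <:+: l.flatten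

/-- The uniform Bernoulli measure of a set of words, as a sum in `[0, ∞]` of the weights
`(1 / |A|) ^ |w|`. -/
noncomputable def uniformMeasure [Fintype A] (X : Set (List A)) : ℝ≥0∞ :=
  ∑' w : X, ((Fintype.card A : ℝ≥0∞)⁻¹) ^ (w : List A).length

/-- A finite (nondeterministic) automaton over `A`, given explicitly as finite data: the list of
initial states, the list of transitions `(p, a, q)` and the list of terminal states, where states
are named by natural numbers. -/
abbrev FiniteAutomaton (A : Type*) : Type _ :=
  List ℕ × List (ℕ × A × ℕ) × List ℕ

/-- The automaton described by the data. -/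
def FiniteAutomaton.toNFA (M : FiniteAutomaton A) : NFA A ℕ where
  step p a := {q | (p, a, q) ∈ M.2.1}
  start := {p | p ∈ M.1}
  accept := {p | p ∈ M.2.2}

/-- The behavior of an automaton: the set of the labels of its successful paths. -/
def FiniteAutomaton.behavior (M : FiniteAutomaton A) : Set (List A) :=
  M.toNFA.accepts

/-- The sets of words presented by finite automata are exactly the regular ones. -/
theorem isRegularSet_iff [Finite A] (X : Set (List A)) :
    IsRegularSet X ↔ ∃ M : FiniteAutomaton A, M.behavior = X := by
  classical
  constructor
  · rintro ⟨σ, _, D, rfl⟩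
    cases nonempty_fintype A
    let e : σ → ℕ := fun s => (Fintype.equivFin σ s : ℕ)
    have he : Function.Injective e := fun s t h =>
      (Fintype.equivFin σ).injective (Fin.ext h)
    let M : FiniteAutomaton A :=
      ([e D.start],
        (Finset.univ : Finset (σ × A)).toList.map (fun p => (e p.1, p.2, e (D.step p.1 p.2))),
        (Finset.univ.filter (· ∈ D.accept)).toList.map e)
    have key : ∀ w, M.toNFA.evalFrom M.toNFA.start w = {e (D.eval w)} := by
      intro w
      induction w using List.reverseRecOn with
      | nil => ext q; simp [M, FiniteAutomaton.toNFA]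
      | append_singleton w a ih =>
        rw [NFA.evalFrom_append, ih]
        ext q
        simp only [NFA.evalFrom_singleton, NFA.stepSet_singleton, FiniteAutomaton.toNFA, M,
          Set.mem_ofPred_eq, List.mem_map, Finset.mem_toList, Finset.mem_univ, true_and,
          Prod.exists, Prod.mk.injEq, DFA.eval_append_singleton, Set.mem_singleton_iff]
        constructor
        · rintro ⟨s, b, h1, rfl, rfl⟩
          rw [he h1]
        · rintro rfl
          exact ⟨_, _, rfl, rfl, rfl⟩
    refine ⟨M, Set.ext fun w => ?_⟩
    change (∃ s ∈ M.toNFA.accept, s ∈ M.toNFA.evalFrom M.toNFA.start w) ↔ D.eval w ∈ D.accept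
    rw [key]
    simp only [FiniteAutomaton.toNFA, M, Set.mem_ofPred_eq, List.mem_map, Finset.mem_toList,
      Finset.mem_filter, Finset.mem_univ, true_and, Set.mem_singleton_iff, exists_eq_right]
    exact ⟨fun ⟨s, hs, h⟩ => he h ▸ hs, fun h => ⟨_, h, rfl⟩⟩
  · rintro ⟨M, rfl⟩
    refine Language.IsRegular.of_finite_range_leftQuotient ?_
    let F : Set ℕ := {q | q ∈ M.1 ++ M.2.1.map (fun t => t.2.2)}
    have hF : F.Finite := List.finite_toSet _
    have hsub : ∀ w, M.toNFA.evalFrom M.toNFA.start w ⊆ F := by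
      intro w
      induction w using List.reverseRecOn with
      | nil => intro q hq; exact List.mem_append_left _ hq
      | append_singleton w a ih =>
        rw [NFA.evalFrom_append]
        intro q hq
        obtain ⟨p, -, hp⟩ := NFA.mem_stepSet.1 hq
        exact List.mem_append_right _ (List.mem_map.2 ⟨(p, a, q), hp, rfl⟩)
    refine (hF.finite_subsets.image M.toNFA.acceptsFrom).subset ?_
    rintro _ ⟨w, rfl⟩
    refine ⟨_, hsub w, ?_⟩
    ext y
    exact (NFA.append_mem_acceptsFrom M.toNFA).symm

end PrefixCode

/-!
The implications between the four conditions run in a circle.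

A complete regular set has measure at least `1` (`one_le_uniformMeasure_of_isComplete`): since
`X∗` is regular, the sets `u⁻¹ X∗ v⁻¹` are finitely many, and completeness says that they cover
all words, whose total measure is infinite. So one of them has infinite measure, hence `X∗` has,
whereas `μ(X) < 1` would bound `μ(X∗)` by a convergent geometric series. With the Kraft–McMillan
inequality, a complete regular code has measure exactly `1`, and by the same inequality a code of
measure `1` cannot be enlarged. A maximal code is in particular maximal among independent codes.

The remaining step is an Ehrenfeucht–Rozenberg completion (`exists_complete_extension`). If `X` is
not complete, some word `z` is not a factor of any word of `X∗`; it may begin with any letter `a`.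
For a letter `b ≠ a` and `n` large, `y = z a bⁿ` is unbordered, so its occurrences in a word never
overlap. Add to `X` the words `y u₁ y ⋯ uₘ y` whose gaps `uᵢ` contain no `y` and are not in `X∗`.
A word is cut by its occurrences of `y` into gaps, and whether a gap lies in `X∗` determines where
the factors end: so the result is a code, and it is complete. If an added word is at
distance at most `k ≤ n` from another word, it differs from it only within its final run of `b`'s.
A word of `X` would then contain `z`, and two distinct added words would either differ in a letter
of these runs, both equal to `b`, or overlap two occurrences of `y`; so the result is again
independent. The construction preserves regularity,
which gives the embedding into a regular maximal code.

For decidability, a regular code is maximal among independent codes if and only if it is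
independent and complete. If a language has at most `N` left quotients, each is attained by a word
of length at most `N`; and explicit bounds on the number of left quotients are at hand for the
behavior of an automaton, for `X∗`, and for the set of factors of `X∗`. Hence independence and
completeness need to be tested only on words of explicitly bounded length, and both tests are
primitive recursive.
-/

open scoped Computability

namespace PrefixCode

variable {A : Type*}

/-! ### Counting left quotients of regular languages -/

/-- The language `L` has at most `N` left quotients. -/
def QuotientBound (L : Language A) (N : ℕ) : Prop :=
  ∃ S : Finset (Language A), (∀ w, L.leftQuotient w ∈ S) ∧ S.card ≤ N

/-- If the left quotient by `w` depends only on a state `Φ w`, the left quotients are at most as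
many as the states. -/
theorem QuotientBound.of_factor {τ : Type*} {L : Language A} (Φ : List A → τ)
    (g : τ → Language A) (S : Finset τ) (hS : ∀ w, Φ w ∈ S)
    (h : ∀ w, L.leftQuotient w = g (Φ w)) : QuotientBound L S.card := by
  classical
  exact ⟨S.image g, fun w => h w ▸ Finset.mem_image_of_mem g (hS w), Finset.card_image_le⟩

theorem QuotientBound.mono {L : Language A} {M N : ℕ} (h : QuotientBound L M) (hMN : M ≤ N) :
    QuotientBound L N :=
  let ⟨S, h₁, h₂⟩ := h
  ⟨S, h₁, h₂.trans hMN⟩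

theorem isRegular_iff_exists_quotientBound {L : Language A} :
    L.IsRegular ↔ ∃ N, QuotientBound L N := by
  rw [Language.isRegular_iff_finite_range_leftQuotient]
  constructor
  · intro h
    exact ⟨_, h.toFinset, fun w => by simp, le_rfl⟩
  · rintro ⟨N, S, hS, -⟩
    exact S.finite_toSet.subset (by rintro _ ⟨w, rfl⟩; exact hS w)

theorem QuotientBound.leftQuotient {L : Language A} {N : ℕ} (h : QuotientBound L N)
    (u : List A) : QuotientBound (L.leftQuotient u) N :=
  let ⟨S, h₁, h₂⟩ := h
  ⟨S, fun w => by rw [← Language.leftQuotient_append]; exact h₁ _, h₂⟩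

/-- Every left quotient is already attained by a short word: among the prefixes of a longer word,
two have the same left quotient, and the segment between them can be cut out. -/
theorem QuotientBound.exists_short {L : Language A} {N : ℕ} (h : QuotientBound L N)
    (w : List A) : ∃ v : List A, v.length ≤ N ∧ L.leftQuotient v = L.leftQuotient w := by
  obtain ⟨S, hS, hc⟩ := h
  induction hn : w.length using Nat.strong_induction_on generalizing w with
  | _ n ih =>
    by_cases hw : w.length ≤ N
    · exact ⟨w, hw, rfl⟩
    push Not at hw
    obtain ⟨i, hi, j, hj, hne, heq⟩ := Finset.exists_ne_map_eq_of_card_lt_of_maps_to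
      (s := Finset.range (N + 1)) (t := S) (f := fun i => L.leftQuotient (w.take i))
      (by simpa using hc.trans_lt (Nat.lt_succ_self N)) (fun i _ => hS _)
    wlog hij : i < j generalizing i j
    · exact this j hj i hi hne.symm heq.symm (by omega)
    simp only [Finset.mem_range] at hi hj
    have hcut : L.leftQuotient (w.take i ++ w.drop j) = L.leftQuotient w := by
      conv_rhs => rw [← List.take_append_drop j w]
      rw [Language.leftQuotient_append, Language.leftQuotient_append]
      exact congrArg (fun K : Language A => K.leftQuotient (w.drop j)) heq
    obtain ⟨v, hv, hv'⟩ := ih (w.take i ++ w.drop j).length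
      (by simp only [List.length_append, List.length_take, List.length_drop]; omega) _ rfl
    exact ⟨v, hv, hv'.trans hcut⟩

/-- The subset construction, on the states which are initial or the target of a transition. -/
theorem quotientBound_behavior (M : FiniteAutomaton A) :
    QuotientBound (M.behavior : Language A) (2 ^ (M.1.length + M.2.1.length)) := by
  classical
  let F : Finset ℕ := (M.1 ++ M.2.1.map (fun t => t.2.2)).toFinset
  have hsub : ∀ w, M.toNFA.evalFrom M.toNFA.start w ⊆ F := by
    intro w
    induction w using List.reverseRecOn with
    | nil => intro q hq; exact List.mem_toFinset.2 (List.mem_append_left _ hq)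
    | append_singleton w a ih =>
      rw [NFA.evalFrom_append]
      intro q hq
      obtain ⟨p, -, hp⟩ := NFA.mem_stepSet.1 hq
      exact List.mem_toFinset.2
        (List.mem_append_right _ (List.mem_map.2 ⟨(p, a, q), hp, rfl⟩))
  refine (QuotientBound.of_factor
    (fun w => F.filter (· ∈ M.toNFA.evalFrom M.toNFA.start w))
    (fun T => M.toNFA.acceptsFrom (T : Set ℕ)) F.powerset
    (fun w => Finset.mem_powerset.2 (Finset.filter_subset _ _)) fun w => ?_).mono ?_
  · have : ((F.filter (· ∈ M.toNFA.evalFrom M.toNFA.start w) : Finset ℕ) : Set ℕ)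
        = M.toNFA.evalFrom M.toNFA.start w := by
      ext q
      simpa using fun h => hsub w h
    rw [this]
    ext y
    exact NFA.append_mem_acceptsFrom M.toNFA
  · rw [Finset.card_powerset]
    refine Nat.pow_le_pow_right two_pos ((List.toFinset_card_le _).trans ?_)
    simp

/-- A factorization of `w ++ x` over `L` is cut between two factors, or inside a factor that
begins in `w` and ends in `x`. -/
theorem append_mem_kstar_iff {L : Language A} {w x : List A} :
    w ++ x ∈ L∗ ↔ (w ∈ L∗ ∧ x ∈ L∗) ∨
      ∃ u v, w = u ++ v ∧ u ∈ L∗ ∧ x ∈ L.leftQuotient v * L∗ := by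
  constructor
  · intro h
    obtain ⟨l, hl, hmem⟩ := Language.mem_kstar.1 h
    rcases List.flatten_eq_append_iff.1 hl.symm with
      ⟨as, bs, rfl, rfl, rfl⟩ | ⟨as, bs, c, cs, ds, rfl, rfl, rfl⟩
    · exact .inl ⟨Language.join_mem_kstar fun y hy => hmem y (by simp [hy]),
        Language.join_mem_kstar fun y hy => hmem y (by simp [hy])⟩
    · exact .inr ⟨_, bs, rfl, Language.join_mem_kstar fun y hy => hmem y (by simp [hy]),
        Language.append_mem_mul (hmem (bs ++ c :: cs) (by simp))
          (Language.join_mem_kstar fun y hy => hmem y (by simp [hy]))⟩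
  · rintro (⟨hw, hx⟩ | ⟨u, v, rfl, hu, hx⟩)
    · obtain ⟨l, rfl, hl⟩ := Language.mem_kstar.1 hw
      obtain ⟨m, rfl, hm⟩ := Language.mem_kstar.1 hx
      rw [← List.flatten_append]
      exact Language.join_mem_kstar fun y hy => (List.mem_append.1 hy).elim (hl y) (hm y)
    · obtain ⟨l, rfl, hl⟩ := Language.mem_kstar.1 hu
      obtain ⟨t, ht, s, hs, rfl⟩ := Language.mem_mul.1 hx
      obtain ⟨m, rfl, hm⟩ := Language.mem_kstar.1 hs
      have : l.flatten ++ v ++ (t ++ m.flatten) = (l ++ (v ++ t) :: m).flatten := by simp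
      rw [this]
      refine Language.join_mem_kstar fun y hy => ?_
      rcases List.mem_append.1 hy with hy | hy
      · exact hl y hy
      · rcases List.mem_cons.1 hy with rfl | hy
        · exact ht
        · exact hm y hy

theorem append_mem_mul_iff {L K : Language A} {w x : List A} :
    w ++ x ∈ L * K ↔ (∃ u v, w = u ++ v ∧ u ∈ L ∧ x ∈ K.leftQuotient v) ∨
      x ∈ L.leftQuotient w * K := by
  constructor
  · intro h
    obtain ⟨a, ha, b, hb, hab⟩ := Language.mem_mul.1 h
    rcases List.append_eq_append_iff.1 hab with ⟨v, rfl, rfl⟩ | ⟨v, rfl, rfl⟩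
    · exact .inl ⟨a, v, rfl, ha, hb⟩
    · exact .inr (Language.append_mem_mul ha hb)
  · rintro (⟨u, v, rfl, hu, hx⟩ | h)
    · rw [List.append_assoc]
      exact Language.append_mem_mul hu hx
    · obtain ⟨a, ha, b, hb, rfl⟩ := Language.mem_mul.1 h
      rw [← List.append_assoc]
      exact Language.append_mem_mul ha hb

/-- By `append_mem_kstar_iff`, the left quotient of `L∗` by `w` depends only on whether `w ∈ L∗` and
on the left quotients of `L` by the `v` with `w = u ++ v`, `u ∈ L∗`. -/
theorem QuotientBound.kstar {L : Language A} {N : ℕ} (h : QuotientBound L N) :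
    QuotientBound L∗ (2 ^ N * 2) := by
  classical
  obtain ⟨S, hS, hc⟩ := h
  refine (QuotientBound.of_factor
    (fun w => (S.filter (fun q => ∃ u v, w = u ++ v ∧ u ∈ L∗ ∧ q = L.leftQuotient v),
      decide (w ∈ L∗)))
    (fun T => {x | (T.2 = true ∧ x ∈ L∗) ∨ ∃ q ∈ T.1, x ∈ q * L∗})
    (S.powerset ×ˢ Finset.univ) (fun w => by simp [em]) fun w => ?_).mono ?_
  · ext x
    refine append_mem_kstar_iff.trans ?_
    change _ ↔ (_ ∨ _)
    simp only [decide_eq_true_eq, Finset.mem_filter]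
    refine or_congr Iff.rfl ⟨?_, ?_⟩
    · rintro ⟨u, v, rfl, hu, hx⟩
      exact ⟨_, ⟨hS v, u, v, rfl, hu, rfl⟩, hx⟩
    · rintro ⟨_, ⟨-, u, v, rfl, hu, rfl⟩, hx⟩
      exact ⟨u, v, rfl, hu, hx⟩
  · rw [Finset.card_product, Finset.card_powerset]
    exact Nat.mul_le_mul (Nat.pow_le_pow_right two_pos hc) (by simp)

theorem isRegular_mul {L K : Language A} (hL : L.IsRegular) (hK : K.IsRegular) :
    (L * K).IsRegular := by
  classical
  obtain ⟨_, S, hS, -⟩ := isRegular_iff_exists_quotientBound.1 hL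
  obtain ⟨_, T, hT, -⟩ := isRegular_iff_exists_quotientBound.1 hK
  refine isRegular_iff_exists_quotientBound.2 ⟨_, QuotientBound.of_factor
    (fun w => (T.filter (fun q => ∃ u v, w = u ++ v ∧ u ∈ L ∧ q = K.leftQuotient v),
      L.leftQuotient w))
    (fun P => {x | (∃ q ∈ P.1, x ∈ q) ∨ x ∈ P.2 * K})
    (T.powerset ×ˢ S) (fun w => by simp [hS]) fun w => ?_⟩
  ext x
  refine append_mem_mul_iff.trans ?_
  change _ ↔ (_ ∨ _)
  simp only [Finset.mem_filter]
  refine or_congr ⟨?_, ?_⟩ Iff.rfl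
  · rintro ⟨u, v, rfl, hu, hx⟩
    exact ⟨_, ⟨hT v, u, v, rfl, hu, rfl⟩, hx⟩
  · rintro ⟨_, ⟨-, u, v, rfl, hu, rfl⟩, hx⟩
    exact ⟨u, v, rfl, hu, hx⟩

theorem isRegular_kstar {L : Language A} (hL : L.IsRegular) : (L∗).IsRegular :=
  let ⟨_, h⟩ := isRegular_iff_exists_quotientBound.1 hL
  isRegular_iff_exists_quotientBound.2 ⟨_, h.kstar⟩

theorem isRegular_singleton (y : List A) : ({y} : Language A).IsRegular := by
  classical
  refine Language.IsRegular.of_finite_range_leftQuotient ?_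
  refine (((List.finite_toSet y.tails).image fun t => ({t} : Language A)).insert
    (0 : Language A)).subset ?_
  rintro _ ⟨w, rfl⟩
  by_cases h : w <+: y
  · obtain ⟨t, rfl⟩ := h
    refine Set.mem_insert_of_mem _ ⟨t, by simp, ?_⟩
    ext x
    change x = t ↔ w ++ x = w ++ t
    simp
  · refine Set.mem_insert_iff.2 (.inl ?_)
    ext x
    exact iff_of_false (fun hx => h ⟨x, hx⟩) (Language.notMem_zero x)

theorem isRegular_univ : IsRegularSet (Set.univ : Set (List A)) := by
  refine Language.IsRegular.of_finite_range_leftQuotient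
    ((Set.finite_singleton (Set.univ : Set (List A))).subset ?_)
  rintro _ ⟨w, rfl⟩
  rfl

/-- The factors of the words of `L`. -/
def factors (L : Language A) : Language A :=
  {w | ∃ u v, u ++ w ++ v ∈ L}

theorem QuotientBound.factors {L : Language A} {N : ℕ} (h : QuotientBound L N) :
    QuotientBound (factors L) (2 ^ N) := by
  classical
  obtain ⟨S, hS, hc⟩ := h
  -- a left quotient by `w` is determined by the set of states `w` leads to from any state
  refine (QuotientBound.of_factor
    (fun w => S.filter (fun q => ∃ u, q = L.leftQuotient (u ++ w)))
    (fun T => {x | ∃ q ∈ T, ∃ v, x ++ v ∈ q}) S.powerset (fun w => by simp) fun w => ?_).mono ?_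
  · ext x
    change (∃ u v, u ++ (w ++ x) ++ v ∈ L) ↔ ∃ q ∈ S.filter _, ∃ v, x ++ v ∈ q
    simp only [Finset.mem_filter]
    constructor
    · rintro ⟨u, v, h⟩
      exact ⟨_, ⟨hS (u ++ w), u, rfl⟩, v, by simpa [List.append_assoc] using h⟩
    · rintro ⟨_, ⟨-, u, rfl⟩, v, h⟩
      exact ⟨u, v, by simpa [List.append_assoc] using h⟩
  · rw [Finset.card_powerset]
    exact Nat.pow_le_pow_right two_pos hc

theorem QuotientBound.exists_short_context {L : Language A} {N : ℕ} (h : QuotientBound L N)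
    {w : List A} (hw : w ∈ PrefixCode.factors L) :
    ∃ u v : List A, u.length ≤ N ∧ v.length ≤ N ∧ u ++ w ++ v ∈ L := by
  obtain ⟨u, v, huv⟩ := hw
  obtain ⟨u', hu', e⟩ := h.exists_short u
  obtain ⟨v', hv', e'⟩ := (h.leftQuotient (u ++ w)).exists_short v
  refine ⟨u', v', hu', hv', ?_⟩
  have h₁ : v' ∈ L.leftQuotient (u ++ w) := by
    have : [] ∈ (L.leftQuotient (u ++ w)).leftQuotient v := by simpa using huv
    rw [← e'] at this
    simpa using this
  rwa [Language.leftQuotient_append, ← e, ← Language.leftQuotient_append] at h₁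

theorem isComplete_iff {X : Set (List A)} :
    IsComplete X ↔ ∀ w, w ∈ factors ((X : Language A)∗) := by
  refine forall_congr' fun w => ⟨?_, ?_⟩
  · rintro ⟨l, hl, u, v, h⟩
    exact ⟨u, v, Language.mem_kstar.2 ⟨l, h, hl⟩⟩
  · rintro ⟨u, v, h⟩
    obtain ⟨l, h, hl⟩ := Language.mem_kstar.1 h
    exact ⟨l, hl, u, v, h⟩

/-! ### The uniform Bernoulli measure -/

section Measure

variable [Fintype A]

theorem uniformMeasure_mono {X Y : Set (List A)} (h : X ⊆ Y) :
    uniformMeasure X ≤ uniformMeasure Y :=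
  ENNReal.tsum_mono_subtype (fun w : List A => ((Fintype.card A : ℝ≥0∞)⁻¹) ^ w.length) h

/-- The words of each given length contribute the weight `1`. -/
theorem uniformMeasure_univ [Nonempty A] : uniformMeasure (Set.univ : Set (List A)) = ⊤ := by
  unfold uniformMeasure
  rw [tsum_univ (fun w : List A => ((Fintype.card A : ℝ≥0∞)⁻¹) ^ w.length),
    ← (Equiv.sigmaFiberEquiv (List.length (α := A))).tsum_eq, ENNReal.tsum_sigma']
  have h : ∀ n : ℕ, ∑' w : {w : List A // w.length = n},
      ((Fintype.card A : ℝ≥0∞)⁻¹) ^ (w : List A).length = 1 := by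
    intro n
    have : ∀ w : {w : List A // w.length = n},
        ((Fintype.card A : ℝ≥0∞)⁻¹) ^ (w : List A).length = ((Fintype.card A : ℝ≥0∞)⁻¹) ^ n :=
      fun w => by rw [w.2]
    rw [tsum_congr this]
    change ∑' _ : List.Vector A n, _ = _
    rw [tsum_fintype, Finset.sum_const, Finset.card_univ, card_vector, nsmul_eq_mul,
      Nat.cast_pow, ← mul_pow, ENNReal.mul_inv_cancel (by simp) (by simp), one_pow]
  refine (tsum_congr h).trans ?_
  simp

theorem uniformMeasure_mul_le (L K : Language A) :
    uniformMeasure (L * K : Language A) ≤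
      uniformMeasure (L : Set (List A)) * uniformMeasure (K : Set (List A)) := by
  have hsurj : Function.Surjective (fun p : {a // a ∈ L} × {b // b ∈ K} =>
      (⟨p.1.1 ++ p.2.1, Language.append_mem_mul p.1.2 p.2.2⟩ : {x // x ∈ L * K})) := by
    rintro ⟨x, hx⟩
    obtain ⟨a, ha, b, hb, rfl⟩ := Language.mem_mul.1 hx
    exact ⟨(⟨a, ha⟩, ⟨b, hb⟩), rfl⟩
  refine (ENNReal.tsum_le_tsum_comp_of_surjective hsurj
    fun x => ((Fintype.card A : ℝ≥0∞)⁻¹) ^ (x : List A).length).trans (le_of_eq ?_)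
  simp only [List.length_append, pow_add]
  rw [ENNReal.tsum_prod (f := fun (a : {a // a ∈ L}) (b : {b // b ∈ K}) =>
    ((Fintype.card A : ℝ≥0∞)⁻¹) ^ (a : List A).length *
      ((Fintype.card A : ℝ≥0∞)⁻¹) ^ (b : List A).length)]
  simp only [ENNReal.tsum_mul_left, ENNReal.tsum_mul_right]
  rfl

theorem uniformMeasure_singleton (w : List A) :
    uniformMeasure ({w} : Set (List A)) = ((Fintype.card A : ℝ≥0∞)⁻¹) ^ w.length := by
  unfold uniformMeasure
  rw [tsum_singleton w (fun w : List A => ((Fintype.card A : ℝ≥0∞)⁻¹) ^ w.length)]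

theorem uniformMeasure_pow_le (L : Language A) (n : ℕ) :
    uniformMeasure (L ^ n : Language A) ≤ uniformMeasure (L : Set (List A)) ^ n := by
  induction n with
  | zero =>
    rw [pow_zero, pow_zero]
    exact ((uniformMeasure_singleton ([] : List A)).trans (pow_zero _)).le
  | succ n ih =>
    rw [pow_succ, pow_succ]
    exact (uniformMeasure_mul_le _ _).trans (mul_le_mul_left ih _)

theorem uniformMeasure_iUnion_le {ι : Type*} (t : ι → Set (List A)) :
    uniformMeasure (⋃ i, t i) ≤ ∑' i, uniformMeasure (t i) :=
  ENNReal.tsum_iUnion_le_tsum (fun w : List A => ((Fintype.card A : ℝ≥0∞)⁻¹) ^ w.length) t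

theorem uniformMeasure_kstar_lt_top {L : Language A}
    (h : uniformMeasure (L : Set (List A)) < 1) : uniformMeasure (L∗ : Language A) < ⊤ := by
  have hsub : ∀ x ∈ L∗, x ∈ ⋃ n : ℕ, (show Set (List A) from L ^ n) := by
    intro x hx
    rw [Language.kstar_eq_iSup_pow] at hx
    exact Set.mem_iUnion.2 (Language.mem_iSup.1 hx)
  refine ((uniformMeasure_mono (X := (L∗ : Language A)) hsub).trans
    ((uniformMeasure_iUnion_le _).trans (ENNReal.tsum_le_tsum fun n => uniformMeasure_pow_le L n))).trans_lt ?_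
  rw [ENNReal.tsum_geometric]
  exact ENNReal.inv_lt_top.2 (tsub_pos_of_lt h)

theorem uniformMeasure_context_lt_top {L : Set (List A)} (u v : List A)
    (h : uniformMeasure L < ⊤) : uniformMeasure {w | u ++ w ++ v ∈ L} < ⊤ := by
  have hc : ((Fintype.card A : ℝ≥0∞)⁻¹) ^ (u.length + v.length) ≠ 0 := by simp
  have hle : uniformMeasure {w | u ++ w ++ v ∈ L} *
      ((Fintype.card A : ℝ≥0∞)⁻¹) ^ (u.length + v.length) ≤ uniformMeasure L := by
    let f : {w | u ++ w ++ v ∈ L} → L := fun w => ⟨u ++ w.1 ++ v, w.2⟩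
    have hf : Function.Injective f := by
      intro w w' hw
      have := congrArg Subtype.val hw
      exact Subtype.ext (by simpa [f] using this)
    unfold uniformMeasure
    rw [← ENNReal.tsum_mul_right]
    refine le_trans (le_of_eq (tsum_congr fun w => ?_)) (ENNReal.tsum_comp_le_tsum_of_injective hf
      fun w : L => ((Fintype.card A : ℝ≥0∞)⁻¹) ^ (w : List A).length)
    rw [← pow_add]
    congr 1
    simp [f]
    omega
  by_contra htop
  rw [not_lt_top_iff] at htop
  rw [htop, ENNReal.top_mul hc] at hle
  exact (hle.trans_lt h).false

/-- All words are factors of words of `X*`, and as `X*` is regular, they are distributed over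
finitely many sets `u⁻¹ X* v⁻¹`. One of these has infinite measure, hence so has `X*`. -/
theorem one_le_uniformMeasure_of_isComplete [Nonempty A] {X : Language A}
    (hreg : X.IsRegular) (hX : IsComplete X) : 1 ≤ uniformMeasure X := by
  by_contra! hlt
  have htop := uniformMeasure_kstar_lt_top hlt
  obtain ⟨σ, _, D, hD⟩ := isRegular_kstar hreg
  let t : σ × Set σ → Set (List A) := fun p =>
    {w | ∃ u v, D.eval u = p.1 ∧ {s | D.evalFrom s v ∈ D.accept} = p.2 ∧
      D.evalFrom p.1 w ∈ p.2}
  have ht : ∀ p, uniformMeasure (t p) < ⊤ := by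
    rintro ⟨s, T⟩
    by_cases h : ∃ u v, D.eval u = s ∧ {s | D.evalFrom s v ∈ D.accept} = T
    · obtain ⟨u, v, rfl, rfl⟩ := h
      refine (uniformMeasure_mono ?_).trans_lt (uniformMeasure_context_lt_top u v htop)
      rintro w ⟨-, -, -, -, hw⟩
      change u ++ w ++ v ∈ X∗
      rw [← hD, DFA.mem_accepts, DFA.eval, DFA.evalFrom_of_append, DFA.evalFrom_of_append]
      exact hw
    · have : t (s, T) = ∅ := by
        ext w
        simp only [t, Set.mem_empty_iff_false, iff_false]
        rintro ⟨u, v, hu, hv, -⟩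
        exact h ⟨u, v, hu, hv⟩
      rw [this]
      simp [uniformMeasure]
  -- `t (s, T)` is `u⁻¹ X∗ v⁻¹` for any `u` leading to the state `s` and any `v` accepted from
  -- exactly the states in `T`, and empty if there are none
  have hcov : (Set.univ : Set (List A)) ⊆ ⋃ p, t p := by
    intro w _
    obtain ⟨u, v, huv⟩ := isComplete_iff.1 hX w
    rw [← hD, DFA.mem_accepts, DFA.eval, DFA.evalFrom_of_append, DFA.evalFrom_of_append] at huv
    exact Set.mem_iUnion.2 ⟨(D.eval u, {s | D.evalFrom s v ∈ D.accept}), u, v, rfl, rfl, huv⟩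
  have hfin := (uniformMeasure_mono hcov).trans (uniformMeasure_iUnion_le t)
  rw [uniformMeasure_univ, top_le_iff] at hfin
  have := Fintype.ofFinite (σ × Set σ)
  rw [tsum_fintype] at hfin
  exact (ENNReal.sum_lt_top.2 fun p _ => ht p).ne hfin

/-- The Kraft–McMillan inequality for possibly infinite codes. -/
theorem uniformMeasure_le_one [Nonempty A] {X : Set (List A)} (hX : IsCode X) :
    uniformMeasure X ≤ 1 := by
  classical
  unfold uniformMeasure
  rw [ENNReal.tsum_eq_iSup_sum]
  refine iSup_le fun s => ?_
  have hs : IsCode ((s.map (Function.Embedding.subtype _) : Finset (List A)) : Set (List A)) :=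
    fun l m hl hm => hX l m (fun w hw => by
      obtain ⟨a, -, rfl⟩ := Finset.mem_map.1 (hl w hw)
      exact a.2) (fun w hw => by
      obtain ⟨a, -, rfl⟩ := Finset.mem_map.1 (hm w hw)
      exact a.2)
  have := InformationTheory.kraft_mcmillan_inequality hs
  rw [Finset.sum_map] at this
  have hcast := ENNReal.ofReal_le_ofReal this
  rw [ENNReal.ofReal_sum_of_nonneg (fun _ _ => by positivity), ENNReal.ofReal_one] at hcast
  refine (Finset.sum_congr rfl fun w _ => ?_).trans_le hcast
  rw [ENNReal.ofReal_pow (by positivity), one_div, ENNReal.ofReal_inv_of_pos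
    (by exact_mod_cast Fintype.card_pos), ENNReal.ofReal_natCast]
  rfl

theorem maximal_isCode_of_uniformMeasure_eq_one [Nonempty A] {X : Set (List A)} (hX : IsCode X)
    (h : uniformMeasure X = 1) : Maximal IsCode X := by
  refine ⟨hX, fun Y hY hXY w hw => ?_⟩
  by_contra hwX
  have hle := (uniformMeasure_mono (Set.union_subset hXY (Set.singleton_subset_iff.2 hw))).trans
    (uniformMeasure_le_one hY)
  have hadd : uniformMeasure (X ∪ {w}) = uniformMeasure X + uniformMeasure {w} := by
    unfold uniformMeasure
    exact ENNReal.summable.tsum_union_disjoint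
      (f := fun w : List A => ((Fintype.card A : ℝ≥0∞)⁻¹) ^ w.length)
      (Set.disjoint_singleton_right.2 hwX) ENNReal.summable
  rw [hadd, h, uniformMeasure_singleton] at hle
  have hpos : ((Fintype.card A : ℝ≥0∞)⁻¹) ^ w.length ≠ 0 := by simp
  exact (ENNReal.lt_add_right ENNReal.one_ne_top hpos).not_ge hle

end Measure

/-! ### Independence with respect to the prefix metric -/

section Distance

variable [DecidableEq A]

/-- Removing the longest common prefix leaves two words which do not begin with the same
letter. -/
theorem exists_of_prefixDist_le {w w' : List A} {k : ℕ} (h : prefixDist w w' ≤ k) :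
    ∃ p s s', w = p ++ s ∧ w' = p ++ s' ∧ s.length + s'.length ≤ k ∧
      ∀ c t t', s = c :: t → s' ≠ c :: t' := by
  obtain ⟨⟨s, hs⟩, ⟨s', hs'⟩⟩ := (prefix_commonPrefix_iff (commonPrefix w w') w w').1 List.prefix_rfl
  refine ⟨_, s, s', hs.symm, hs'.symm, ?_, ?_⟩
  · have h₁ := congrArg List.length hs
    have h₂ := congrArg List.length hs'
    rw [List.length_append] at h₁ h₂
    unfold prefixDist at h
    omega
  · rintro c t t' rfl rfl
    have := (prefix_commonPrefix_iff (commonPrefix w w' ++ [c]) w w').2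
      ⟨⟨t, by simpa using hs⟩, ⟨t', by simpa using hs'⟩⟩
    have := this.length_le
    simp at this

theorem prefixDist_append_le (p s s' : List A) :
    prefixDist (p ++ s) (p ++ s') ≤ s.length + s'.length := by
  have := ((prefix_commonPrefix_iff p (p ++ s) (p ++ s')).2
    ⟨List.prefix_append _ _, List.prefix_append _ _⟩).length_le
  unfold prefixDist
  simp only [List.length_append]
  omega

theorem prefixDist_comm (w w' : List A) : prefixDist w w' = prefixDist w' w := by
  have h : ∀ u v : List A, (commonPrefix u v).length ≤ (commonPrefix v u).length := fun u v =>
    ((prefix_commonPrefix_iff _ v u).2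
      ((prefix_commonPrefix_iff (commonPrefix u v) u v).1 List.prefix_rfl).symm).length_le
  unfold prefixDist
  rw [(h w w').antisymm (h w' w), add_comm]

theorem isIndependent_iff {k : ℕ} {X : Set (List A)} :
    IsIndependent (antiReflexive (prefixRel k)) X ↔
      ∀ x ∈ X, ∀ x' ∈ X, prefixDist x x' ≤ k → x = x' := by
  unfold IsIndependent
  rw [Set.eq_empty_iff_forall_notMem]
  constructor
  · intro h x hx x' hx' hd
    by_contra hne
    exact h x' ⟨⟨x, hx, hd, hne⟩, hx'⟩
  · rintro h x' ⟨⟨x, hx, hd, hne⟩, hx'⟩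
    exact hne (h x hx x' hx' hd)

end Distance

/-! ### Unbordered words -/

/-- A word is unbordered if no nonempty proper prefix of it is a suffix of it. -/
def IsUnbordered (y : List A) : Prop :=
  ∀ v, v <+: y → v <:+ y → v ≠ [] → v = y

theorem eq_replicate_of_suffix {s w : List A} {b : A} {n : ℕ} (hs : s <:+ w)
    (hb : List.replicate n b <:+ w) (hn : s.length ≤ n) : s = List.replicate s.length b := by
  have h : s <:+ List.replicate n b := List.suffix_of_suffix_length_le hs hb (by simpa using hn)
  exact List.eq_replicate_of_mem fun c hc => List.eq_of_mem_replicate (h.subset hc)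

theorem isUnbordered_append_replicate {z : List A} {a b : A} {n : ℕ} (hab : a ≠ b)
    (hn : z.length ≤ n) (hz : z.head? = some a) :
    IsUnbordered (z ++ a :: List.replicate n b) := by
  intro v hpre hsuf hv
  have hrep : List.replicate n b <:+ z ++ a :: List.replicate n b := ⟨z ++ [a], by simp⟩
  rcases le_or_gt v.length n with hvn | hvn
  · exfalso
    have h := eq_replicate_of_suffix hsuf hrep hvn
    obtain ⟨c, t, rfl⟩ := List.exists_cons_of_ne_nil hv
    obtain ⟨d, z', rfl⟩ : ∃ d z', z = d :: z' := by
      cases z with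
      | nil => simp at hz
      | cons d z' => exact ⟨d, z', rfl⟩
    have hda : d = a := by simpa using hz
    have hcd : c = d := by
      obtain ⟨r, hr⟩ := hpre
      exact (List.cons.inj hr).1
    have hcb : c = b := List.eq_of_mem_replicate (h ▸ List.mem_cons_self)
    exact hab (hda.symm.trans (hcd.symm.trans hcb))
  · -- the last letter of `v` different from `b` is at position `|v| - n - 1`, and at `|z|`
    by_contra hne
    have hlen : v.length < (z ++ a :: List.replicate n b).length :=
      lt_of_le_of_ne hpre.length_le fun h => hne (hpre.eq_of_length h)
    obtain ⟨e, he⟩ := hsuf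
    have hel : e.length + v.length = z.length + (n + 1) := by
      simpa using congrArg List.length he
    have h₁ : v[z.length]? = some a := by
      obtain ⟨r, hr⟩ := hpre
      rw [← List.getElem?_append_left (l₂ := r) (by omega), hr]
      simp
    have h₂ : v[z.length]? = some b := by
      have : v[z.length]? = (e ++ v)[e.length + z.length]? := by
        rw [List.getElem?_append_right (by omega)]
        congr 1
        omega
      simp only [List.length_append, List.length_cons, List.length_replicate] at hlen
      obtain ⟨i, hi⟩ : ∃ i, e.length = i + 1 := ⟨e.length - 1, by omega⟩
      rw [this, he, List.getElem?_append_right (by omega), hi,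
        show i + 1 + z.length - z.length = i + 1 by omega, List.getElem?_cons_succ,
        List.getElem?_replicate_of_lt (by omega)]
    exact hab (Option.some.inj (h₁.symm.trans h₂))

/-- Occurrences of an unbordered word do not overlap, so that the first one is well defined. -/
theorem IsUnbordered.append_inj {y v v' s s' : List A} (hy : IsUnbordered y)
    (hv : ¬ y <:+: v) (hv' : ¬ y <:+: v') (h : v ++ (y ++ s) = v' ++ (y ++ s')) :
    v = v' ∧ s = s' := by
  suffices H : ∀ {v v' s s' : List A}, ¬ y <:+: v' → v ++ (y ++ s) = v' ++ (y ++ s') →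
      v.length ≤ v'.length → v = v' by
    have hvv : v = v' := by
      rcases le_total v.length v'.length with hl | hl
      · exact H hv' h hl
      · exact (H hv h.symm hl).symm
    subst hvv
    exact ⟨rfl, by simpa using h⟩
  intro v v' s s' hv' h hl
  obtain ⟨d, rfl⟩ : v <+: v' :=
    List.prefix_of_prefix_length_le ⟨_, h⟩ (List.prefix_append _ _) hl
  have h' : y ++ s = d ++ (y ++ s') := by simpa using h
  rcases le_or_gt y.length d.length with hyd | hyd
  · exfalso
    obtain ⟨r, rfl⟩ : y <+: d :=
      List.prefix_of_prefix_length_le ⟨_, h'⟩ (List.prefix_append _ _) hyd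
    exact hv' ⟨v, r, by simp⟩
  · obtain ⟨e, he⟩ : d <+: y :=
      List.prefix_of_prefix_length_le ⟨_, h'.symm⟩ (List.prefix_append _ _) hyd.le
    have hes : e ++ s = y ++ s' := by
      have : d ++ (e ++ s) = d ++ (y ++ s') := by rw [← h', ← he, List.append_assoc]
      simpa using this
    have hle : e.length ≤ y.length := by rw [← he]; simp
    have hepre : e <+: y :=
      List.prefix_of_prefix_length_le ⟨s, hes⟩ (List.prefix_append _ _) hle
    have hene : e ≠ [] := by
      rintro rfl
      rw [List.append_nil] at he
      rw [he] at hyd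
      exact hyd.false
    have := hy e hepre ⟨d, he⟩ hene
    rw [this] at he
    have : d = [] := by simpa using he
    simp [this]

theorem exists_first_occurrence {y w : List A} (hy : y ≠ []) (h : y <:+: w) :
    ∃ v s, w = v ++ (y ++ s) ∧ ¬ y <:+: v := by
  classical
  have h' : ∃ n v s, w = v ++ (y ++ s) ∧ v.length = n := by
    obtain ⟨v, s, rfl⟩ := h
    exact ⟨_, v, s, by simp, rfl⟩
  obtain ⟨v, s, hw, hl⟩ := Nat.find_spec h'
  refine ⟨v, s, hw, ?_⟩
  rintro ⟨v₁, s₁, rfl⟩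
  refine Nat.find_min h' (m := v₁.length) ?_ ⟨v₁, s₁ ++ (y ++ s), by simp [hw], rfl⟩
  rw [← hl]
  have := List.length_pos_of_ne_nil hy
  simp only [List.length_append]
  omega

/-! ### The Ehrenfeucht–Rozenberg completion -/

/-- The words without an occurrence of `y` which have no factorization over `X`. -/
def gapWords (X : Language A) (y : List A) : Language A :=
  {u | ¬ y <:+: u ∧ u ∉ X∗}

/-- The words `y u₁ y u₂ ⋯ uₙ y`, whose gaps `uᵢ` are in `gapWords X y`. -/
def completionWords (X : Language A) (y : List A) : Language A :=
  {y} * (gapWords X y * {y})∗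

section Completion

variable {X : Language A} {y : List A}

theorem mem_completionWords_iff {w : List A} :
    w ∈ completionWords X y ↔
      ∃ us : List (List A), (∀ u ∈ us, u ∈ gapWords X y) ∧ w = y ++ us.flatMap (· ++ y) := by
  constructor
  · intro h
    obtain ⟨y', hy', t, ht, rfl⟩ := Language.mem_mul.1 h
    obtain rfl : y' = y := hy'
    obtain ⟨l, rfl, hl⟩ := Language.mem_kstar.1 ht
    suffices ∃ us : List (List A), (∀ u ∈ us, u ∈ gapWords X y') ∧
        l.flatten = us.flatMap (· ++ y') by
      obtain ⟨us, hus, e⟩ := this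
      exact ⟨us, hus, by rw [e]⟩
    clear h ht
    induction l with
    | nil => exact ⟨[], by simp, rfl⟩
    | cons x l ih =>
      obtain ⟨us, hus, e⟩ := ih fun z hz => hl z (List.mem_cons_of_mem _ hz)
      obtain ⟨u, hu, v, hv, rfl⟩ := Language.mem_mul.1 (hl x List.mem_cons_self)
      obtain rfl : v = y' := hv
      exact ⟨u :: us, List.forall_mem_cons.2 ⟨hu, hus⟩, by rw [List.flatten_cons, e]; rfl⟩
  · rintro ⟨us, hus, rfl⟩
    refine Language.append_mem_mul rfl (Language.join_mem_kstar fun x hx => ?_)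
    obtain ⟨u, hu, rfl⟩ := List.mem_map.1 hx
    exact Language.append_mem_mul (hus u hu) rfl

theorem suffix_of_mem_completionWords {w : List A} (h : w ∈ completionWords X y) : y <:+ w := by
  obtain ⟨us, -, rfl⟩ := mem_completionWords_iff.1 h
  rcases us.eq_nil_or_concat with rfl | ⟨us, u, rfl⟩
  · simp
  · exact ⟨y ++ us.flatMap (· ++ y) ++ u, by simp⟩

theorem not_infix_of_notMem_factors {x : List A} (hy : y ∉ factors X∗) (hx : x ∈ X∗) :
    ¬ y <:+: x := by
  rintro ⟨u, v, rfl⟩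
  exact hy ⟨u, v, hx⟩

theorem append_mem_kstar {u v : List A} (hu : u ∈ X∗) (hv : v ∈ X∗) : u ++ v ∈ X∗ :=
  append_mem_kstar_iff.2 (.inl ⟨hu, hv⟩)

/-- The final `y` closes the last gap, so that every word `w` is cut by its occurrences of `y`. -/
theorem exists_gap_decomposition (hy : y ≠ []) (w : List A) :
    ∃ vs : List (List A), (∀ v ∈ vs, ¬ y <:+: v) ∧ w ++ y = vs.flatMap (· ++ y) := by
  induction hn : w.length using Nat.strong_induction_on generalizing w with
  | _ n ih =>
    by_cases h : y <:+: w
    · obtain ⟨v, s, rfl, hv⟩ := exists_first_occurrence hy h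
      obtain ⟨vs, hvs, e⟩ := ih s.length (by
        have := List.length_pos_of_ne_nil hy
        simp only [List.length_append] at hn
        omega) s rfl
      exact ⟨v :: vs, List.forall_mem_cons.2 ⟨hv, hvs⟩, by simp [← e]⟩
    · exact ⟨[w], by simpa using h, by simp⟩

theorem isComplete_completion (hy : y ≠ []) : IsComplete (X + completionWords X y) := by
  have hsub : ∀ x ∈ X∗, x ∈ (X + completionWords X y)∗ := by
    intro x hx
    obtain ⟨l, rfl, hl⟩ := Language.mem_kstar.1 hx
    exact Language.join_mem_kstar fun z hz => (Language.mem_add _ _ _).2 (.inl (hl z hz))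
  have hY : ∀ x ∈ completionWords X y, x ∈ (X + completionWords X y)∗ := fun x hx =>
    Language.mem_kstar.2 ⟨[x], by simp, by simpa using (Language.mem_add _ _ _).2 (.inr hx)⟩
  -- `us` collects the gaps of the current word of the completion, which ends at the first gap
  -- that has a factorization over `X`
  have key : ∀ vs us : List (List A), (∀ v ∈ vs, ¬ y <:+: v) → (∀ u ∈ us, u ∈ gapWords X y) →
      y ++ us.flatMap (· ++ y) ++ vs.flatMap (· ++ y) ∈ (X + completionWords X y)∗ := by
    intro vs
    induction vs with
    | nil =>
      intro us _ hus
      rw [List.flatMap_nil, List.append_nil]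
      exact hY _ (mem_completionWords_iff.2 ⟨us, hus, rfl⟩)
    | cons v vs ih =>
      intro us hvs hus
      obtain ⟨hv, hvs⟩ := List.forall_mem_cons.1 hvs
      by_cases hvX : v ∈ X∗
      · have h₁ := hY _ (mem_completionWords_iff.2 ⟨us, hus, rfl⟩)
        have h₂ := ih [] hvs (by simp)
        have := append_mem_kstar h₁ (append_mem_kstar (hsub v hvX) h₂)
        simpa using this
      · have := ih (us ++ [v]) hvs (List.forall_mem_append.2 ⟨hus, by simpa using ⟨hv, hvX⟩⟩)
        simpa using this
  refine isComplete_iff.2 fun w => ?_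
  obtain ⟨vs, hvs, e⟩ := exists_gap_decomposition hy w
  refine ⟨y, y, ?_⟩
  have := key vs [] hvs (by simp)
  rwa [← e, List.flatMap_nil, List.append_nil, ← List.append_assoc] at this

theorem exists_first_completionWord {l : List (List A)}
    (hl : ∀ x ∈ l, x ∈ X + completionWords X y) :
    (∀ x ∈ l, x ∈ X) ∨ ∃ (l₀ us l' : List (List A)), l = l₀ ++ (y ++ us.flatMap (· ++ y)) :: l' ∧
      (∀ x ∈ l₀, x ∈ X) ∧ (∀ u ∈ us, u ∈ gapWords X y) ∧
      ∀ x ∈ l', x ∈ X + completionWords X y := by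
  induction l with
  | nil => exact .inl (by simp)
  | cons x l ih =>
    obtain ⟨hx, hl'⟩ := List.forall_mem_cons.1 hl
    rcases (Language.mem_add _ _ _).1 hx with hx | hx
    · rcases ih hl' with h | ⟨l₀, us, l', rfl, h₁, h₂⟩
      · exact .inl (List.forall_mem_cons.2 ⟨hx, h⟩)
      · exact .inr ⟨x :: l₀, us, l', rfl, List.forall_mem_cons.2 ⟨hx, h₁⟩, h₂⟩
    · obtain ⟨us, hus, rfl⟩ := mem_completionWords_iff.1 hx
      exact .inr ⟨[], us, l, rfl, by simp, hus, hl'⟩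

/-- A product of words of the completed code has a prefix in `X∗` before its first `y`, which a
gap word is not. -/
theorem flatten_ne_gap_append (hub : IsUnbordered y) (hyX : y ∉ factors X∗) {u r : List A}
    (hu : u ∈ gapWords X y) {l : List (List A)} (hl : ∀ x ∈ l, x ∈ X + completionWords X y) :
    l.flatten ≠ u ++ (y ++ r) := by
  intro h
  rcases exists_first_completionWord hl with hX | ⟨l₀, us, l', rfl, h₀, -, -⟩
  · exact not_infix_of_notMem_factors hyX (Language.join_mem_kstar hX) ⟨u, r, by simp [h]⟩
  · have hmem := Language.join_mem_kstar h₀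
    simp only [List.flatten_append, List.flatten_cons, List.append_assoc] at h
    obtain ⟨e, -⟩ := hub.append_inj (not_infix_of_notMem_factors hyX hmem) hu.1 h
    exact hu.2 (e ▸ hmem)

/-- The end of a word of the completion can be read off from a product beginning with it: it is
at the first gap with a factorization over `X`. -/
theorem gap_list_unique (hub : IsUnbordered y) (hyX : y ∉ factors X∗)
    {us us' : List (List A)} (hus : ∀ u ∈ us, u ∈ gapWords X y)
    (hus' : ∀ u ∈ us', u ∈ gapWords X y) {l m : List (List A)}
    (hl : ∀ x ∈ l, x ∈ X + completionWords X y) (hm : ∀ x ∈ m, x ∈ X + completionWords X y)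
    (h : us.flatMap (· ++ y) ++ l.flatten = us'.flatMap (· ++ y) ++ m.flatten) :
    us = us' ∧ l.flatten = m.flatten := by
  induction us generalizing us' with
  | nil =>
    cases us' with
    | nil => exact ⟨rfl, by simpa using h⟩
    | cons u us' =>
      simp only [List.flatMap_cons, List.flatMap_nil, List.nil_append, List.append_assoc] at h
      exact absurd h (flatten_ne_gap_append hub hyX (hus' u List.mem_cons_self) hl)
  | cons u us ih =>
    cases us' with
    | nil =>
      simp only [List.flatMap_cons, List.flatMap_nil, List.nil_append, List.append_assoc] at h
      exact absurd h.symm (flatten_ne_gap_append hub hyX (hus u List.mem_cons_self) hm)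
    | cons u' us' =>
      obtain ⟨hu, hus⟩ := List.forall_mem_cons.1 hus
      obtain ⟨hu', hus'⟩ := List.forall_mem_cons.1 hus'
      simp only [List.flatMap_cons, List.append_assoc] at h
      obtain ⟨e, h₁⟩ := hub.append_inj hu.1 hu'.1 h
      obtain ⟨e', h₂⟩ := ih hus hus' h₁
      exact ⟨by rw [e, e'], h₂⟩

/-- In a product of words of the completed code, the occurrences of `y` are determined, and the
gaps between them which have a factorization over `X` are those between two factors. -/
theorem isCode_completion (hX : IsCode X) (hub : IsUnbordered y) (hyX : y ∉ factors X∗) :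
    IsCode (X + completionWords X y) := by
  have aux : ∀ {l₀ us l' m : List (List A)}, (∀ x ∈ m, x ∈ X) →
      (l₀ ++ (y ++ us.flatMap (· ++ y)) :: l').flatten ≠ m.flatten := by
    intro l₀ us l' m hm h
    exact not_infix_of_notMem_factors hyX (Language.join_mem_kstar hm)
      ⟨l₀.flatten, us.flatMap (· ++ y) ++ l'.flatten, by simp [← h]⟩
  intro l
  induction hn : l.length using Nat.strong_induction_on generalizing l with
  | _ n ih =>
    intro m hl hm h
    rcases exists_first_completionWord hl with hlX | ⟨l₀, us, l', rfl, h₁, h₂, h₃⟩ <;>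
      rcases exists_first_completionWord hm with hmX | ⟨m₀, us', m', rfl, h₁', h₂', h₃'⟩
    · exact hX l m hlX hmX h
    · exact absurd h.symm (aux hlX)
    · exact absurd h (aux hmX)
    · simp only [List.flatten_append, List.flatten_cons, List.append_assoc] at h
      obtain ⟨e, h⟩ := hub.append_inj
        (not_infix_of_notMem_factors hyX (Language.join_mem_kstar h₁))
        (not_infix_of_notMem_factors hyX (Language.join_mem_kstar h₁')) h
      obtain ⟨rfl, h'⟩ := gap_list_unique hub hyX h₂ h₂' h₃ h₃' h
      rw [hX l₀ m₀ h₁ h₁' e, ih l'.length (by simp at hn; omega) l' rfl m' h₃ h₃' h']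

theorem isRegular_completion (hX : X.IsRegular) : (X + completionWords X y).IsRegular := by
  have hU : gapWords X y = ((⊤ * {y} * ⊤ + X∗ : Language A))ᶜ := by
    ext u
    change (¬ _ ∧ _) ↔ ¬ (_ ∨ _)
    rw [not_or]
    refine and_congr (not_congr ⟨?_, ?_⟩) Iff.rfl
    · rintro ⟨s, t, rfl⟩
      exact Language.append_mem_mul (Language.append_mem_mul trivial rfl) trivial
    · intro h
      obtain ⟨x, hx, t, -, rfl⟩ := Language.mem_mul.1 h
      obtain ⟨s, -, y', hy', rfl⟩ := Language.mem_mul.1 hx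
      obtain rfl : y' = y := hy'
      exact ⟨s, t, rfl⟩
  have htop : (⊤ : Language A).IsRegular := isRegular_univ
  have hy := isRegular_singleton y
  refine hX.add (isRegular_mul hy (isRegular_kstar (isRegular_mul ?_ hy)))
  rw [hU]
  exact ((isRegular_mul (isRegular_mul htop hy) htop).add (isRegular_kstar hX)).compl

/-- The long run of the letter `b` at the end of `y` keeps the words of the completion away from
each other, and from the words of `X`, in which `z` does not occur. -/
theorem eq_of_prefixDist_le_of_mem_completion [DecidableEq A] {k n : ℕ} {z : List A} {a b : A}
    (hyz : y = z ++ a :: List.replicate n b) (hk : k ≤ n) (hub : IsUnbordered y)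
    (hz : z ∉ factors X∗) (hX : ∀ x ∈ X, ∀ x' ∈ X, prefixDist x x' ≤ k → x = x') :
    ∀ w ∈ X + completionWords X y, ∀ w' ∈ X + completionWords X y,
      prefixDist w w' ≤ k → w = w' := by
  have hrep : ∀ {w : List A}, w ∈ completionWords X y → List.replicate n b <:+ w := fun h =>
    List.IsSuffix.trans ⟨z ++ [a], by simp [hyz]⟩ (suffix_of_mem_completionWords h)
  have hny : n < y.length := by simp [hyz]; omega
  have hXY : ∀ x ∈ X, ∀ w ∈ completionWords X y, ¬ prefixDist x w ≤ k := by
    intro x hx w hw hd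
    obtain ⟨p, s, s', rfl, rfl, hlen, -⟩ := exists_of_prefixDist_le hd
    obtain ⟨q, hq⟩ := suffix_of_mem_completionWords hw
    have hpre : q ++ z ++ [a] <+: p :=
      List.prefix_of_prefix_length_le (l₃ := p ++ s') ⟨List.replicate n b, by simp [← hq, hyz]⟩
        (List.prefix_append _ _) (by
          have := congrArg List.length hq
          simp only [hyz, List.length_append, List.length_cons, List.length_replicate,
            List.length_nil] at this ⊢
          omega)
    obtain ⟨r, rfl⟩ := hpre
    exact hz ⟨q, a :: r ++ s, Language.mem_kstar.2
      ⟨[q ++ z ++ [a] ++ r ++ s], by simp, by simpa using hx⟩⟩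
  -- a word of the completion cannot be prolonged by a short word, as `y` is unbordered
  have hYY : ∀ {w s : List A}, w ∈ completionWords X y → w ++ s ∈ completionWords X y →
      s.length ≤ n → s = [] := by
    intro w s hw hws hs
    obtain ⟨e, he⟩ : s <:+ y := List.suffix_of_suffix_length_le (List.suffix_append w s)
      (suffix_of_mem_completionWords hws) (by omega)
    have hew : e <:+ w := by
      obtain ⟨q, hq⟩ := suffix_of_mem_completionWords hws
      rw [← he, ← List.append_assoc] at hq
      exact ⟨q, List.append_cancel_right hq⟩
    have hey : e <:+ y := List.suffix_of_suffix_length_le hew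
      (suffix_of_mem_completionWords hw) (by rw [← he]; simp)
    have hene : e ≠ [] := by
      rintro rfl
      rw [← he] at hny
      simp at hny
      omega
    have := hub e ⟨s, he⟩ hey hene
    rw [this] at he
    simpa using he
  intro w hw w' hw' hd
  rcases (Language.mem_add _ _ _).1 hw with hw | hw <;>
    rcases (Language.mem_add _ _ _).1 hw' with hw' | hw'
  · exact hX w hw w' hw' hd
  · exact absurd hd (hXY w hw w' hw')
  · exact absurd (prefixDist_comm w w' ▸ hd) (hXY w' hw' w hw)
  · obtain ⟨p, s, s', rfl, rfl, hlen, hdiff⟩ := exists_of_prefixDist_le hd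
    have hs := eq_replicate_of_suffix (List.suffix_append p s) (hrep hw) (by omega)
    have hs' := eq_replicate_of_suffix (List.suffix_append p s') (hrep hw') (by omega)
    cases s with
    | nil =>
      rw [List.append_nil] at hw ⊢
      rw [hYY hw hw' (by omega), List.append_nil]
    | cons c t =>
      cases s' with
      | nil =>
        rw [List.append_nil] at hw' ⊢
        rw [hYY hw' hw (by omega), List.append_nil]
      | cons c' t' =>
        rw [List.length_cons, List.replicate_succ] at hs hs'
        exact absurd ((List.cons.inj hs').1.trans (List.cons.inj hs).1.symm ▸ rfl)
          (hdiff c t t' rfl)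

end Completion

/-- The words `z` and `y` of the construction: `z = a w` for a word `w` that is not a factor of
`X∗`, and `y = z a bⁿ` with `n` at least `k` and the length of `z`. -/
theorem exists_complete_extension [Fintype A] [DecidableEq A] (hA : 2 ≤ Fintype.card A) {k : ℕ}
    {X : Language A} (hX : IsIndependentCode k X) (hc : ¬ IsComplete X) :
    ∃ Y : Set (List A), (∀ x ∈ X, x ∈ Y) ∧ IsIndependentCode k Y ∧ IsComplete Y ∧
      (X.IsRegular → IsRegularSet Y) := by
  obtain ⟨w, hw⟩ := not_forall.1 (fun h => hc (isComplete_iff.2 h))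
  have hnt : Nontrivial A := Fintype.one_lt_card_iff_nontrivial.1 hA
  obtain ⟨a, b, hab⟩ := exists_pair_ne A
  obtain ⟨n, hn, hk⟩ : ∃ n, (a :: w).length ≤ n ∧ k ≤ n := ⟨_, le_max_left _ _, le_max_right _ _⟩
  have hz : a :: w ∉ factors X∗ := by
    rintro ⟨u, v, h⟩
    exact hw ⟨u ++ [a], v, by simpa using h⟩
  have hub := isUnbordered_append_replicate hab hn (z := a :: w) rfl
  generalize hy : a :: w ++ a :: List.replicate n b = y at hub
  have hyX : y ∉ factors X∗ := by
    rintro ⟨u, v, h⟩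
    exact hz ⟨u, a :: List.replicate n b ++ v, by simpa [← hy] using h⟩
  exact ⟨X + completionWords X y, fun x hx => .inl hx, ⟨isCode_completion hX.1 hub hyX,
    isIndependent_iff.2 (eq_of_prefixDist_le_of_mem_completion hy.symm hk hub hz
      (isIndependent_iff.1 hX.2))⟩, isComplete_completion (by simp [← hy]), isRegular_completion⟩

/-! ### Bounded quantifiers and primitive recursion -/

/-- The list of all words of length at most `n` over the letters in `s`. -/
def wordsUpTo {α : Type*} (s : List α) : ℕ → List (List α)
  | 0 => [[]]
  | n + 1 => [] :: (wordsUpTo s n).flatMap fun w => s.map (· :: w)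

theorem mem_wordsUpTo {α : Type*} {s : List α} {n : ℕ} {w : List α} :
    w ∈ wordsUpTo s n ↔ w.length ≤ n ∧ ∀ a ∈ w, a ∈ s := by
  induction n generalizing w with
  | zero => cases w <;> simp [wordsUpTo]
  | succ n ih =>
    cases w with
    | nil => simp [wordsUpTo]
    | cons a w =>
      simp only [wordsUpTo, List.mem_cons, List.mem_flatMap, List.mem_map, ih, List.length_cons]
      constructor
      · rintro (h | ⟨v, ⟨h₁, h₂⟩, b, hb, h⟩)
        · simp at h
        · obtain ⟨rfl, rfl⟩ := List.cons.inj h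
          exact ⟨by omega, by simpa using ⟨hb, h₂⟩⟩
      · rintro ⟨h₁, h₂⟩
        exact .inr ⟨w, ⟨by omega, fun b hb => h₂ b (.inr hb)⟩, a, h₂ a (.inl rfl), rfl⟩

section Primrec

variable {α β : Type*} [Primcodable α] [Primcodable β]

theorem primrecPred_forall_mem {f : α → List β} (hf : Primrec f) {p : α × β → Prop}
    (hp : PrimrecPred p) : PrimrecPred fun a => ∀ b ∈ f a, p (a, b) :=
  hp.primrecRel.swap.forall_mem_list.comp hf Primrec.id

theorem primrecPred_exists_mem {f : α → List β} (hf : Primrec f) {p : α × β → Prop}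
    (hp : PrimrecPred p) : PrimrecPred fun a => ∃ b ∈ f a, p (a, b) :=
  hp.primrecRel.swap.exists_mem_list.comp hf Primrec.id

theorem primrecPred_imp {p q : α → Prop} (hp : PrimrecPred p) (hq : PrimrecPred q) :
    PrimrecPred fun a => p a → q a :=
  (hp.not.or hq).of_eq fun _ => imp_iff_not_or.symm

theorem primrecRel_mem_list : PrimrecRel fun (a : α) (l : List α) => a ∈ l :=
  (primrecPred_exists_mem Primrec.snd
    (p := fun x : (α × List α) × α => x.2 = x.1.1)
    (Primrec.eq.comp Primrec.snd (Primrec.fst.comp Primrec.fst))).of_eq fun x => by simp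

theorem primrec_two_pow : Primrec fun n : ℕ => 2 ^ n :=
  (Primrec.nat_rec' Primrec.id (Primrec.const 1)
    (h := fun _ p => p.2 * 2)
    (Primrec.nat_mul.comp (Primrec.snd.comp Primrec.snd) (Primrec.const 2))).of_eq fun n => by
    induction n with
    | zero => rfl
    | succ n ih => rw [pow_succ, ← ih]; rfl

theorem primrec_wordsUpTo : Primrec₂ (wordsUpTo : List α → ℕ → List (List α)) := by
  have hg : Primrec₂ fun (s : List α) (p : ℕ × List (List α)) =>
      [] :: p.2.flatMap fun w => s.map (· :: w) := by
    refine Primrec.list_cons.comp (Primrec.const []) (Primrec.list_flatMap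
      (Primrec.snd.comp Primrec.snd) ?_)
    exact Primrec.list_map (Primrec.fst.comp Primrec.fst)
      (Primrec.list_cons.comp Primrec.snd (Primrec.snd.comp Primrec.fst))
  refine (Primrec.nat_rec (Primrec.const [[]]) hg).of_eq fun s n => ?_
  induction n with
  | zero => rfl
  | succ n ih => simp only [wordsUpTo, ← ih]

end Primrec

/-! ### Deciding independence and completeness -/

section Decidability

/-- One step of the subset construction, on lists of states. -/
def stepList [DecidableEq A] (T : List (ℕ × A × ℕ)) (S : List ℕ) (a : A) : List ℕ :=
  (T.filter fun t => t.1 ∈ S ∧ t.2.1 = a).map fun t => t.2.2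

theorem mem_behavior_iff [DecidableEq A] {M : FiniteAutomaton A} {w : List A} :
    w ∈ M.behavior ↔ ∃ q ∈ w.foldl (stepList M.2.1) M.1, q ∈ M.2.2 := by
  have key : ∀ q, q ∈ w.foldl (stepList M.2.1) M.1 ↔
      q ∈ M.toNFA.evalFrom M.toNFA.start w := by
    induction w using List.reverseRecOn with
    | nil => exact fun q => Iff.rfl
    | append_singleton w a ih =>
      intro q
      rw [List.foldl_append, NFA.evalFrom_append, NFA.evalFrom_singleton, NFA.mem_stepSet]
      simp only [List.foldl_cons, List.foldl_nil, stepList, List.mem_map, List.mem_filter,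
        decide_eq_true_eq, ih]
      constructor
      · rintro ⟨⟨p, b, r⟩, ⟨hT, hp, rfl⟩, rfl⟩
        exact ⟨p, hp, hT⟩
      · rintro ⟨p, hp, hT⟩
        exact ⟨(p, a, q), ⟨hT, hp, rfl⟩, rfl⟩
  refine Iff.trans (b := ∃ q ∈ M.toNFA.accept, q ∈ M.toNFA.evalFrom M.toNFA.start w) Iff.rfl ?_
  exact exists_congr fun q => by rw [key, and_comm]; rfl

/-- Two words at distance at most `k` are `p ++ s` and `p ++ s'` with `s` and `s'` short, and `p`
may be replaced by a short word with the same left quotient. -/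
theorem isIndependent_iff_short [DecidableEq A] {X : Set (List A)} {k N : ℕ}
    (hN : QuotientBound X N) :
    IsIndependent (antiReflexive (prefixRel k)) X ↔
      ∀ p : List A, p.length ≤ N → ∀ s : List A, s.length ≤ k → ∀ s' : List A, s'.length ≤ k →
        p ++ s ∈ X → p ++ s' ∈ X → s.length + s'.length ≤ k → s = s' := by
  rw [isIndependent_iff]
  constructor
  · intro h p _ s _ s' _ hs hs' hle
    simpa using h _ hs _ hs' ((prefixDist_append_le p s s').trans hle)
  · intro h x hx x' hx' hd
    obtain ⟨p, s, s', rfl, rfl, hle, -⟩ := exists_of_prefixDist_le hd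
    obtain ⟨q, hq, e⟩ := hN.exists_short p
    have hmem : ∀ {t}, p ++ t ∈ X → q ++ t ∈ X := fun {t} ht => by
      have : t ∈ Language.leftQuotient X p := ht
      rwa [← e] at this
    rw [h q hq s (by omega) s' (by omega) (hmem hx) (hmem hx') hle]

/-- The set of factors of `X∗` has at most `2 ^ N` left quotients, so a word which is not a factor
may be taken of length at most `2 ^ N`. -/
theorem isComplete_iff_short {X : Language A} {N : ℕ} (hN : QuotientBound X∗ N) :
    IsComplete X ↔ ∀ w : List A, w.length ≤ 2 ^ N → ∃ u : List A, u.length ≤ N ∧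
      ∃ v : List A, v.length ≤ N ∧ u ++ w ++ v ∈ X∗ := by
  refine isComplete_iff.trans ⟨?_, ?_⟩
  · intro h w _
    obtain ⟨u, v, hu, hv, huv⟩ := hN.exists_short_context (h w)
    exact ⟨u, hu, v, hv, huv⟩
  · intro h w
    obtain ⟨w', hw', e⟩ := hN.factors.exists_short w
    obtain ⟨u, -, v, -, huv⟩ := h w' hw'
    have h' : [] ∈ (factors X∗).leftQuotient w' := by
      rw [Language.mem_leftQuotient, List.append_nil]
      exact ⟨u, v, huv⟩
    rw [e, Language.mem_leftQuotient, List.append_nil] at h'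
    exact h'

theorem mem_wordsUpTo_univ [Fintype A] {n : ℕ} {w : List A} :
    w ∈ wordsUpTo (Finset.univ : Finset A).toList n ↔ w.length ≤ n := by
  simp [mem_wordsUpTo]

/-- The number of transitions and initial states, which bounds the number of useful states. -/
def automatonSize (M : FiniteAutomaton A) : ℕ := M.1.length + M.2.1.length

variable [Primcodable A]

theorem primrec_automatonSize : Primrec (automatonSize : FiniteAutomaton A → ℕ) :=
  Primrec.nat_add.comp (Primrec.list_length.comp Primrec.fst)
    (Primrec.list_length.comp (Primrec.fst.comp Primrec.snd))

theorem primrecRel_mem_behavior :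
    PrimrecRel fun (M : FiniteAutomaton A) (w : List A) => w ∈ M.behavior := by
  classical
  have hfilter : Primrec₂ fun (T : List (ℕ × A × ℕ)) (p : List ℕ × A) =>
      T.filter fun t => t.1 ∈ p.1 ∧ t.2.1 = p.2 :=
    PrimrecRel.listFilter (R := fun (t : ℕ × A × ℕ) (p : List ℕ × A) =>
      t.1 ∈ p.1 ∧ t.2.1 = p.2)
      ((primrecRel_mem_list.comp (Primrec.fst.comp Primrec.fst)
          (Primrec.fst.comp Primrec.snd)).and
        (Primrec.eq.comp (Primrec.fst.comp (Primrec.snd.comp Primrec.fst))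
          (Primrec.snd.comp Primrec.snd)))
  have hstep : Primrec₂ fun (x : FiniteAutomaton A × List A) (p : List ℕ × A) =>
      stepList x.1.2.1 p.1 p.2 :=
    Primrec.list_map
      (hfilter.comp (Primrec.fst.comp (Primrec.snd.comp (Primrec.fst.comp Primrec.fst)))
        Primrec.snd)
      (Primrec.snd.comp (Primrec.snd.comp Primrec.snd))
  have hfold : Primrec fun x : FiniteAutomaton A × List A =>
      x.2.foldl (stepList x.1.2.1) x.1.1 :=
    Primrec.list_foldl Primrec.snd (Primrec.fst.comp Primrec.fst) hstep
  refine (primrecPred_exists_mem hfold (p := fun z => z.2 ∈ z.1.1.2.2)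
    (primrecRel_mem_list.comp Primrec.snd
      (Primrec.snd.comp (Primrec.snd.comp (Primrec.fst.comp Primrec.fst))))).of_eq fun x => ?_
  exact mem_behavior_iff.symm

variable [Fintype A]

theorem primrec_wordsUpTo_univ :
    Primrec fun n : ℕ => wordsUpTo (Finset.univ : Finset A).toList n :=
  primrec_wordsUpTo.comp (Primrec.const _) Primrec.id

theorem primrecRel_mem_kstar_behavior :
    PrimrecRel fun (M : FiniteAutomaton A) (w : List A) =>
      w ∈ KStar.kstar (α := Language A) M.behavior := by
  -- a word of length `n` is a product of at most `n` nonempty factors of length at most `n`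
  have hl : Primrec fun x : FiniteAutomaton A × List A =>
      wordsUpTo (wordsUpTo (Finset.univ : Finset A).toList x.2.length) x.2.length :=
    primrec_wordsUpTo.comp (primrec_wordsUpTo_univ.comp (Primrec.list_length.comp Primrec.snd))
      (Primrec.list_length.comp Primrec.snd)
  have hp : PrimrecPred fun z : (FiniteAutomaton A × List A) × List (List A) =>
      (∀ w ∈ z.2, w ∈ z.1.1.behavior) ∧ z.1.2 = z.2.flatten :=
    (primrecPred_forall_mem Primrec.snd
      (p := fun y : ((FiniteAutomaton A × List A) × List (List A)) × List A =>
        y.2 ∈ y.1.1.1.behavior)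
      (primrecRel_mem_behavior.comp (Primrec.fst.comp (Primrec.fst.comp Primrec.fst))
        Primrec.snd)).and
    (Primrec.eq.comp (Primrec.snd.comp Primrec.fst) (Primrec.list_flatten.comp Primrec.snd))
  refine (primrecPred_exists_mem hl hp).of_eq fun x => ⟨?_, ?_⟩
  · rintro ⟨l, -, h, e⟩
    exact Language.mem_kstar.2 ⟨l, e, h⟩
  · intro h
    obtain ⟨l, e, h⟩ := Language.mem_kstar_iff_exists_nonempty.1 h
    refine ⟨l, mem_wordsUpTo.2 ⟨?_, fun w hw => mem_wordsUpTo_univ.2 ?_⟩,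
      fun w hw => (h w hw).1, e⟩
    · rw [e, List.length_flatten]
      simpa using List.card_nsmul_le_sum (l.map List.length) 1 (by
        intro n hn
        obtain ⟨w, hw, rfl⟩ := List.mem_map.1 hn
        exact List.length_pos_of_ne_nil (h w hw).2)
    · rw [e]
      exact (List.sublist_flatten_of_mem hw).length_le

theorem primrecPred_isIndependent [DecidableEq A] :
    PrimrecPred fun x : ℕ × FiniteAutomaton A =>
      IsIndependent (antiReflexive (prefixRel x.1)) x.2.behavior := by
  have hW : Primrec fun x : ℕ × FiniteAutomaton A =>
      wordsUpTo (Finset.univ : Finset A).toList x.1 := primrec_wordsUpTo_univ.comp Primrec.fst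
  have hP : Primrec fun x : ℕ × FiniteAutomaton A =>
      wordsUpTo (Finset.univ : Finset A).toList (2 ^ automatonSize x.2) :=
    primrec_wordsUpTo_univ.comp
      (primrec_two_pow.comp (primrec_automatonSize.comp Primrec.snd))
  have hM : ∀ {g : (((ℕ × FiniteAutomaton A) × List A) × List A) × List A → List A},
      Primrec g → PrimrecPred fun z : (((ℕ × FiniteAutomaton A) × List A) × List A) × List A =>
        z.1.1.2 ++ g z ∈ z.1.1.1.2.behavior := fun hg =>
    primrecRel_mem_behavior.comp
      (Primrec.snd.comp (Primrec.fst.comp (Primrec.fst.comp Primrec.fst)))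
      (Primrec.list_append.comp (Primrec.snd.comp (Primrec.fst.comp Primrec.fst)) hg)
  refine PrimrecPred.of_eq (primrecPred_forall_mem hP (primrecPred_forall_mem (hW.comp Primrec.fst)
    (primrecPred_forall_mem (hW.comp (Primrec.fst.comp Primrec.fst))
      (primrecPred_imp (hM (Primrec.snd.comp Primrec.fst))
        (primrecPred_imp (hM Primrec.snd) (primrecPred_imp (Primrec.nat_le.comp
          (Primrec.nat_add.comp (Primrec.list_length.comp (Primrec.snd.comp Primrec.fst))
            (Primrec.list_length.comp Primrec.snd))
          (Primrec.fst.comp (Primrec.fst.comp (Primrec.fst.comp Primrec.fst))))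
          (Primrec.eq.comp (Primrec.snd.comp Primrec.fst) Primrec.snd))))))) fun x => ?_
  rw [isIndependent_iff_short (quotientBound_behavior x.2)]
  simp only [mem_wordsUpTo_univ]
  rfl

theorem primrecPred_isComplete :
    PrimrecPred fun M : FiniteAutomaton A => IsComplete M.behavior := by
  have hN : Primrec fun M : FiniteAutomaton A => 2 ^ (2 ^ automatonSize M) * 2 :=
    Primrec.nat_mul.comp (primrec_two_pow.comp (primrec_two_pow.comp primrec_automatonSize))
      (Primrec.const 2)
  have hW := (primrec_wordsUpTo_univ (A := A)).comp hN
  have hB := (primrec_wordsUpTo_univ (A := A)).comp (primrec_two_pow.comp hN)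
  have hM : PrimrecPred fun z : ((FiniteAutomaton A × List A) × List A) × List A =>
      z.1.2 ++ z.1.1.2 ++ z.2 ∈ KStar.kstar (α := Language A) z.1.1.1.behavior :=
    primrecRel_mem_kstar_behavior.comp (Primrec.fst.comp (Primrec.fst.comp Primrec.fst))
      (Primrec.list_append.comp (Primrec.list_append.comp (Primrec.snd.comp Primrec.fst)
        (Primrec.snd.comp (Primrec.fst.comp Primrec.fst))) Primrec.snd)
  refine PrimrecPred.of_eq (primrecPred_forall_mem hB (primrecPred_exists_mem (hW.comp Primrec.fst)
    (primrecPred_exists_mem (hW.comp (Primrec.fst.comp Primrec.fst)) hM))) fun M => ?_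
  refine Iff.trans ?_ (isComplete_iff_short (quotientBound_behavior M).kstar).symm
  simp only [mem_wordsUpTo_univ]
  rfl

end Decidability

end PrefixCode

theorem mainTheorem7 {A : Type*} [Fintype A] [DecidableEq A] [Primcodable A]
    (hA : 2 ≤ Fintype.card A) :
    -- the four conditions are equivalent
    (∀ (k : ℕ) (X : Set (List A)),
      PrefixCode.IsRegularSet X → PrefixCode.IsIndependentCode k X →
        List.TFAE
          [Maximal (PrefixCode.IsIndependentCode k) X,
           Maximal PrefixCode.IsCode X,
           PrefixCode.IsComplete X,
           PrefixCode.uniformMeasure X = 1]) ∧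
    -- embedding into a maximal one
    (∀ (k : ℕ) (X : Set (List A)),
      PrefixCode.IsRegularSet X → PrefixCode.IsIndependentCode k X →
        ¬ Maximal (PrefixCode.IsIndependentCode k) X →
          ∃ Y : Set (List A), X ⊆ Y ∧ PrefixCode.IsRegularSet Y ∧
            Maximal (PrefixCode.IsIndependentCode k) Y) ∧
    -- one algorithm decides, given `k` and an automaton presenting a regular code, whether
    -- that code is maximal in the family of independent codes
    (∃ f : ℕ × PrefixCode.FiniteAutomaton A → Bool, Computable f ∧
      ∀ (k : ℕ) (M : PrefixCode.FiniteAutomaton A), PrefixCode.IsCode M.behavior →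
        (f (k, M) = true ↔ Maximal (PrefixCode.IsIndependentCode k) M.behavior)) := by
  classical
  have hne : Nonempty A := Fintype.card_pos_iff.1 (by omega)
  have tfae : ∀ (k : ℕ) (X : Set (List A)),
      PrefixCode.IsRegularSet X → PrefixCode.IsIndependentCode k X →
        List.TFAE
          [Maximal (PrefixCode.IsIndependentCode k) X,
           Maximal PrefixCode.IsCode X,
           PrefixCode.IsComplete X,
           PrefixCode.uniformMeasure X = 1] := by
    intro k X hreg hX
    tfae_have 1 → 3 := by
      intro hmax
      by_contra hc
      obtain ⟨Y, hXY, hY, hYc, -⟩ := PrefixCode.exists_complete_extension hA hX hc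
      exact hc (hmax.eq_of_le hY hXY ▸ hYc)
    tfae_have 3 → 4 := fun hc => le_antisymm (PrefixCode.uniformMeasure_le_one hX.1)
      (PrefixCode.one_le_uniformMeasure_of_isComplete hreg hc)
    tfae_have 4 → 2 := PrefixCode.maximal_isCode_of_uniformMeasure_eq_one hX.1
    tfae_have 2 → 1 := fun hmax => ⟨hX, fun Y hY hXY => hmax.2 hY.1 hXY⟩
    tfae_finish
  refine ⟨tfae, ?_, ?_⟩
  · intro k X hreg hX hmax
    have hc : ¬ PrefixCode.IsComplete X := fun h => hmax (((tfae k X hreg hX).out 0 2).2 h)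
    obtain ⟨Y, hXY, hY, hYc, hYreg⟩ := PrefixCode.exists_complete_extension hA hX hc
    exact ⟨Y, hXY, hYreg hreg, ((tfae k Y (hYreg hreg) hY).out 0 2).2 hYc⟩
  · obtain ⟨_, hdec⟩ := (PrefixCode.primrecPred_isIndependent (A := A)).and
      (PrefixCode.primrecPred_isComplete.comp Primrec.snd)
    refine ⟨_, hdec.to_comp, fun k M hcode => ?_⟩
    rw [decide_eq_true_eq]
    have hreg := (PrefixCode.isRegularSet_iff M.behavior).2 ⟨M, rfl⟩
    constructor
    · rintro ⟨hi, hc⟩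
      exact ((tfae k _ hreg ⟨hcode, hi⟩).out 0 2).2 hc
    · intro hmax
      exact ⟨hmax.prop.2, ((tfae k _ hreg hmax.prop).out 0 2).1 hmax⟩
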